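/- All vector spaces, Lie algebras and manifolds are real, and locally convex spaces are Hausdorff. A \emph{continuous invariant symmetric bilinear form} on a locally convex Lie algebra $L$ is a jointly continuous symmetric bilinear map $\beta\colon L\times L\to V$ into a locally convex space $V$ with $\beta([x,y],z)=\beta(x,[y,z])$ for all $x,y,z\in L$. It is called \emph{topologically universal} if for every continuous invariant symmetric bilinear form $\gamma\colon L\times L\to W$ into a locally convex space $W$ there is a unique continuous linear map $\psi\colon V\to W$ with $\gamma=\psi\circ\beta$. For a finite-dimensional Lie algebra $\mathfrak g$ let $V_{\mathfrak g}$ be the quotient of the symmetric square $S^2(\mathfrak g)$ by the linear span of all elements $[x,y]\vee z-x\vee[y,z]$ with $x,y,z\in\mathfrak g$, and let $\kappa_{\mathfrak g}\colon\mathfrak g\times\mathfrak g\to V_{\mathfrak g}$, $(x,y)\mapsto[x\vee y]$. For a finite-dimensional vector space $F$ and a smooth manifold $M$, the space $C^\infty(M,F)$ of smooth maps carries the topology of uniform convergence of all derivatives on compact subsets of charts. The space $C_c^\infty(M,F)$ of compactly supported smooth maps carries the locally convex inductive limit topology of the subspaces $C^\infty_K(M,F)\subseteq C^\infty(M,F)$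 of maps supported in $K$, where $K$ runs through the compact subsets of $M$. The Lie bracket of $C_c^\infty(M,\mathfrak g)$ is the pointwise one. \textbf{Theorem.} Let $\mathfrak g$ be a finite-dimensional Lie algebra that is perfect, that is, $[\mathfrak g,\mathfrak g]=\mathfrak g$, and let $M$ be a $\sigma$-compact (Hausdorff) finite-dimensional smooth manifold without boundary. Then $C_c^\infty(M,\mathfrak g)$ is a locally convex Lie algebra, and the map \[ (\kappa_{\mathfrak g})_*\colon C_c^\infty(M,\mathfrak g)\times C_c^\infty(M,\mathfrak g)\to C_c^\infty(M,V_{\mathfrak g}),\qquad (f,h)\mapsto\kappa_{\mathfrak g}\circ(f,h), \] is a topologically universal continuous invariant symmetric bilinear form on it. -/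

import Mathlib

open scoped TensorProduct Manifold ContDiff Topology

universe uE uM ug uL uV uW

noncomputable section

namespace UnivForm

/-! ### Smooth maps from a manifold to a finite-dimensional real vector space -/

section Smooth

/-- Linear coordinates on a finite-dimensional real vector space. They are used only to speak of
smoothness and of derivatives of `V`-valued maps; these notions, and the topologies defined from
them below, do not depend on the choice of the basis. -/
def coords (V : Type*) [AddCommGroup V] [Module ℝ V] [FiniteDimensional ℝ V] :
    V ≃ₗ[ℝ] (Fin (Module.finrank ℝ V) → ℝ) :=
  (Module.finBasis ℝ V).equivFun

variable (E : Type*) [NormedAddCommGroup E] [NormedSpace ℝ E]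
variable {M : Type*} [TopologicalSpace M] [ChartedSpace E M]
variable {V : Type*} [AddCommGroup V] [Module ℝ V] [FiniteDimensional ℝ V]
variable {W : Type*} [AddCommGroup W] [Module ℝ W] [FiniteDimensional ℝ W]
variable {U : Type*} [AddCommGroup U] [Module ℝ U] [FiniteDimensional ℝ U]

/-- A map from the manifold `M` (modelled on `E`) to a finite-dimensional real vector space is
smooth if it is smooth in linear coordinates. -/
def IsSmooth (f : M → V) : Prop :=
  ContMDiff 𝓘(ℝ, E) 𝓘(ℝ, Fin (Module.finrank ℝ V) → ℝ) ∞ fun p => coords V (f p)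

variable {E}

/-- Smoothness does not depend on the coordinates: on a finite-dimensional normed space
it is the usual notion. -/
theorem isSmooth_iff_contMDiff {F : Type*} [NormedAddCommGroup F] [NormedSpace ℝ F]
    [FiniteDimensional ℝ F] {f : M → F} :
    IsSmooth E f ↔ ContMDiff 𝓘(ℝ, E) 𝓘(ℝ, F) ∞ f := by
  let c := (coords F).toContinuousLinearEquiv
  constructor
  · intro h
    have h2 := c.symm.toContinuousLinearMap.contMDiff.comp (n := ∞) h
    have : f = (c.symm.toContinuousLinearMap : _ → _) ∘ fun p => coords F (f p) := by
      funext p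
      exact (c.symm_apply_apply (f p)).symm
    rw [this]
    exact h2
  · intro h
    exact c.toContinuousLinearMap.contMDiff.comp (n := ∞) h

theorem IsSmooth.zero : IsSmooth E (0 : M → V) := by
  have h : (fun p : M => coords V ((0 : M → V) p)) = fun _ => 0 := by
    funext p
    simp
  unfold IsSmooth
  rw [h]
  exact contMDiff_const

theorem IsSmooth.add {f g : M → V} (hf : IsSmooth E f) (hg : IsSmooth E g) :
    IsSmooth E (f + g) := by
  have := ContMDiff.add hf hg
  simpa [IsSmooth, Pi.add_def] using this

theorem IsSmooth.const_smul (c : ℝ) {f : M → V} (hf : IsSmooth E f) : IsSmooth E (c • f) := by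
  have h := (c • ContinuousLinearMap.id ℝ (Fin (Module.finrank ℝ V) → ℝ)).contMDiff.comp
    (n := ∞) hf
  have h2 : (fun p : M => coords V ((c • f) p)) =
      (c • ContinuousLinearMap.id ℝ (Fin (Module.finrank ℝ V) → ℝ)) ∘
        fun p => coords V (f p) := by
    funext p
    simp
  unfold IsSmooth
  rw [h2]
  exact h

theorem IsSmooth.bilin (β : V →ₗ[ℝ] W →ₗ[ℝ] U) {f : M → V} {g : M → W}
    (hf : IsSmooth E f) (hg : IsSmooth E g) : IsSmooth E fun p => β (f p) (g p) := by
  let B : (Fin (Module.finrank ℝ V) → ℝ) →ₗ[ℝ] (Fin (Module.finrank ℝ W) → ℝ) →ₗ[ℝ]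
      (Fin (Module.finrank ℝ U) → ℝ) :=
    (β.compl₁₂ (coords V).symm.toLinearMap (coords W).symm.toLinearMap).compr₂
      (coords U).toLinearMap
  let L := LinearMap.toContinuousLinearMap
    ((LinearMap.toContinuousLinearMap (𝕜 := ℝ) (E := Fin (Module.finrank ℝ W) → ℝ)
      (F' := Fin (Module.finrank ℝ U) → ℝ)).toLinearMap ∘ₗ B)
  have h1 : ContMDiff 𝓘(ℝ, E) 𝓘(ℝ, (Fin (Module.finrank ℝ W) → ℝ) →L[ℝ]
      (Fin (Module.finrank ℝ U) → ℝ)) ∞ fun p => L (coords V (f p)) :=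
    L.contMDiff.comp hf
  have h2 := h1.clm_apply hg
  have h3 : (fun p => (L (coords V (f p))) (coords W (g p))) =
      fun p => coords U (β (f p) (g p)) := by
    funext p
    simp [L, B]
  rw [h3] at h2
  exact h2

variable (E M V)

/-- The space `C^∞(M, V)` of smooth maps. -/
def smoothMaps : Submodule ℝ (M → V) where
  carrier := {f | IsSmooth E f}
  zero_mem' := IsSmooth.zero
  add_mem' hf hg := IsSmooth.add hf hg
  smul_mem' c _ hf := IsSmooth.const_smul c hf

/-- The space `C^∞_c(M, V)` of compactly supported smooth maps, as a space of functions. -/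
def compactlySupportedSmoothMaps : Submodule ℝ (M → V) where
  carrier := {f | IsSmooth E f ∧ HasCompactSupport f}
  zero_mem' := ⟨IsSmooth.zero, HasCompactSupport.zero⟩
  add_mem' hf hg := ⟨hf.1.add hg.1, hf.2.add hg.2⟩
  smul_mem' c f hf := ⟨hf.1.const_smul c, hf.2.mono' (by
    refine subset_trans (fun p hp => ?_) (subset_tsupport f)
    intro h0
    exact hp (by simp [h0]))⟩

/-- The space `C^∞(M, V)`; its topology is defined below. -/
def SmoothMap : Type _ := smoothMaps E M V

instance : AddCommGroup (SmoothMap E M V) := inferInstanceAs (AddCommGroup (smoothMaps E M V))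

instance : Module ℝ (SmoothMap E M V) := inferInstanceAs (Module ℝ (smoothMaps E M V))

/-- The space `C^∞_c(M, V)`; its topology is defined below. -/
def CcSmoothMap : Type _ := compactlySupportedSmoothMaps E M V

instance : AddCommGroup (CcSmoothMap E M V) :=
  inferInstanceAs (AddCommGroup (compactlySupportedSmoothMaps E M V))

instance : Module ℝ (CcSmoothMap E M V) :=
  inferInstanceAs (Module ℝ (compactlySupportedSmoothMaps E M V))

instance : FunLike (SmoothMap E M V) M V where
  coe f := f.1
  coe_injective _ _ h := Subtype.ext h

instance : FunLike (CcSmoothMap E M V) M V where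
  coe f := f.1
  coe_injective _ _ h := Subtype.ext h

variable {E M V}

theorem SmoothMap.isSmooth (f : SmoothMap E M V) : IsSmooth E f := f.2

theorem CcSmoothMap.isSmooth (f : CcSmoothMap E M V) : IsSmooth E f := f.2.1

theorem CcSmoothMap.hasCompactSupport (f : CcSmoothMap E M V) : HasCompactSupport f := f.2.2

@[ext] theorem CcSmoothMap.ext {f g : CcSmoothMap E M V} (h : ∀ p, f p = g p) : f = g :=
  DFunLike.ext f g h

@[simp] theorem CcSmoothMap.add_apply (f g : CcSmoothMap E M V) (p : M) :
    (f + g) p = f p + g p := rfl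

@[simp] theorem CcSmoothMap.zero_apply (p : M) : (0 : CcSmoothMap E M V) p = 0 := rfl

@[simp] theorem CcSmoothMap.smul_apply (c : ℝ) (f : CcSmoothMap E M V) (p : M) :
    (c • f) p = c • f p := rfl

/-- The pointwise map `(f, g) ↦ β ∘ (f, g)` induced by a bilinear map `β : V × W → U`
on spaces of compactly supported smooth maps. -/
def pointwise (β : V →ₗ[ℝ] W →ₗ[ℝ] U) :
    CcSmoothMap E M V →ₗ[ℝ] CcSmoothMap E M W →ₗ[ℝ] CcSmoothMap E M U :=
  LinearMap.mk₂ ℝ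
    (fun f g => ⟨fun p => β (f p) (g p), f.2.1.bilin β g.2.1, f.2.2.mono' (by
      refine subset_trans (fun p hp => ?_) (subset_tsupport f.1)
      intro h0
      have h0' : f p = 0 := h0
      exact hp (by simp [h0']))⟩)
    (fun _ _ _ => Subtype.ext (funext fun _ => LinearMap.map_add₂ β _ _ _))
    (fun _ _ _ => Subtype.ext (funext fun _ => LinearMap.map_smul₂ β _ _ _))
    (fun _ _ _ => Subtype.ext (funext fun _ => map_add _ _ _))
    (fun _ _ _ => Subtype.ext (funext fun _ => map_smul _ _ _))

@[simp] theorem pointwise_apply (β : V →ₗ[ℝ] W →ₗ[ℝ] U) (f : CcSmoothMap E M V)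
    (g : CcSmoothMap E M W) (p : M) : pointwise β f g p = β (f p) (g p) := rfl

end Smooth

/-! ### Topologies on spaces of smooth maps -/

section Topologies

variable {E : Type*} [NormedAddCommGroup E] [NormedSpace ℝ E]
variable {M : Type*} [TopologicalSpace M] [ChartedSpace E M]
variable {V : Type*} [AddCommGroup V] [Module ℝ V] [FiniteDimensional ℝ V]

/-- The local representative of a smooth map in a chart, in linear coordinates of `V`. -/
def localRep (f : M → V) (e : OpenPartialHomeomorph M E) :
    E → (Fin (Module.finrank ℝ V) → ℝ) :=
  fun x => coords V (f (e.symm x))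

theorem contDiffOn_localRep [IsManifold 𝓘(ℝ, E) ∞ M] {f : M → V} (hf : IsSmooth E f)
    {e : OpenPartialHomeomorph M E} (he : e ∈ atlas E M) :
    ContDiffOn ℝ ∞ (localRep f e) e.target := by
  have h1 := contMDiffOn_symm_of_mem_maximalAtlas (I := 𝓘(ℝ, E)) (n := ∞)
    (IsManifold.subset_maximalAtlas he)
  exact contMDiffOn_iff_contDiffOn.1 (hf.comp_contMDiffOn h1)

variable (E M V)

/-- Index set for the topology of `C^∞(M, V)`: a chart of the atlas, a compact subset of the
target of this chart, and an order of differentiation. -/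
structure JetIndex where
  chart : OpenPartialHomeomorph M E
  chart_mem : chart ∈ atlas E M
  compact : TopologicalSpace.Compacts E
  compact_subset : (compact : Set E) ⊆ chart.target
  order : ℕ

variable {E M}

variable {V} in
theorem continuousOn_iteratedFDeriv_localRep [IsManifold 𝓘(ℝ, E) ∞ M] {f : M → V}
    (hf : IsSmooth E f) {e : OpenPartialHomeomorph M E} (he : e ∈ atlas E M) (k : ℕ) :
    ContinuousOn (iteratedFDeriv ℝ k (localRep f e)) e.target :=
  ((contDiffOn_localRep hf he).continuousOn_iteratedFDerivWithin
    (m := k) (by exact_mod_cast le_top) e.open_target.uniqueDiffOn).congr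
      fun _ hx => (iteratedFDerivWithin_of_isOpen _ e.open_target hx).symm

variable {V} in
theorem contDiffAt_localRep [IsManifold 𝓘(ℝ, E) ∞ M] {f : M → V} (hf : IsSmooth E f)
    {e : OpenPartialHomeomorph M E} (he : e ∈ atlas E M) (k : ℕ) {x : E} (hx : x ∈ e.target) :
    ContDiffAt ℝ k (localRep f e) x :=
  ((contDiffOn_localRep hf he).contDiffAt (e.open_target.mem_nhds hx)).of_le
    (by exact_mod_cast le_top)

/-- The restriction to a compact subset `K` of the target of a chart of the `k`-th derivative of
the local representative of a smooth map, as an element of the Banach space of continuous maps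
on `K` with the supremum norm. -/
def jet [IsManifold 𝓘(ℝ, E) ∞ M] (i : JetIndex E M) :
    SmoothMap E M V →ₗ[ℝ]
      C(i.compact, E [×i.order]→L[ℝ] (Fin (Module.finrank ℝ V) → ℝ)) where
  toFun f := ⟨fun x => iteratedFDeriv ℝ i.order (localRep f i.chart) x,
    ((continuousOn_iteratedFDeriv_localRep f.isSmooth i.chart_mem i.order).mono
      i.compact_subset).domRestrict⟩
  map_add' f g := by
    ext1 x
    have hx := i.compact_subset x.2
    have h : localRep (f + g : SmoothMap E M V) i.chart
        = localRep f i.chart + localRep g i.chart :=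
      funext fun _ => map_add (coords V) _ _
    exact (congrArg (fun u => iteratedFDeriv ℝ i.order u (x : E)) h).trans
      (iteratedFDeriv_add_apply (contDiffAt_localRep f.isSmooth i.chart_mem _ hx)
        (contDiffAt_localRep g.isSmooth i.chart_mem _ hx))
  map_smul' c f := by
    ext1 x
    have hx := i.compact_subset x.2
    have h : localRep (c • f : SmoothMap E M V) i.chart = c • localRep f i.chart :=
      funext fun _ => map_smul (coords V) _ _
    exact (congrArg (fun u => iteratedFDeriv ℝ i.order u (x : E)) h).trans
      (iteratedFDeriv_const_smul_apply (contDiffAt_localRep f.isSmooth i.chart_mem _ hx))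

/-- The usual topology of `C^∞(M, V)`: uniform convergence of all derivatives of the local
representatives on compact subsets of the charts. -/
instance SmoothMap.topologicalSpace [IsManifold 𝓘(ℝ, E) ∞ M] :
    TopologicalSpace (SmoothMap E M V) :=
  ⨅ i : JetIndex E M, TopologicalSpace.induced (jet V i) inferInstance

variable (E)

/-- The subspace `C^∞_K(M, V)` of `C^∞(M, V)` of maps with support in `K`; as a subtype it
carries the subspace topology. -/
abbrev SmoothMapOn (K : Set M) : Type _ := {f : SmoothMap E M V // tsupport f ⊆ K}

variable {E V}

/-- The inclusion of `C^∞_K(M, V)` in `C^∞_c(M, V)` for compact `K`. -/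
def SmoothMapOn.toCc [T2Space M] {K : Set M} (hK : IsCompact K) (f : SmoothMapOn E V K) :
    CcSmoothMap E M V :=
  ⟨f.1, f.1.2, HasCompactSupport.of_support_subset_isCompact hK
    ((subset_tsupport _).trans f.2)⟩

/-- The topology of `C^∞_c(M, V)`: the inductive limit topology, in the category of locally convex
spaces, of the spaces `C^∞_K(M, V)` with `K ⊆ M` compact. It is the finest locally convex vector
space topology for which all the inclusions `C^∞_K(M, V) → C^∞_c(M, V)` are continuous. -/
instance CcSmoothMap.topologicalSpace [T2Space M] [IsManifold 𝓘(ℝ, E) ∞ M] :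
    TopologicalSpace (CcSmoothMap E M V) :=
  sInf {t : TopologicalSpace (CcSmoothMap E M V) |
    (∀ (K : Set M) (hK : IsCompact K),
      Continuous[inferInstance, t] (SmoothMapOn.toCc (E := E) (V := V) hK)) ∧
    @IsTopologicalAddGroup _ t _ ∧ @ContinuousSMul ℝ _ _ _ t ∧
    @LocallyConvexSpace ℝ _ _ _ _ _ t}

end Topologies

/-! ### The Lie algebra of compactly supported smooth maps -/

section Lie

variable {E : Type*} [NormedAddCommGroup E] [NormedSpace ℝ E]
variable {M : Type*} [TopologicalSpace M] [ChartedSpace E M]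
variable {g : Type*} [LieRing g] [LieAlgebra ℝ g] [FiniteDimensional ℝ g]

/-- The pointwise bracket `[f, h](p) = [f(p), h(p)]` on `C^∞_c(M, g)`. -/
instance : LieRing (CcSmoothMap E M g) where
  bracket f h := pointwise (LieModule.toEnd ℝ g g : g →ₗ[ℝ] g →ₗ[ℝ] g) f h
  add_lie _ _ _ := LinearMap.map_add₂ _ _ _ _
  lie_add _ _ _ := map_add _ _ _
  lie_self _ := CcSmoothMap.ext fun _ => lie_self _
  leibniz_lie _ _ _ := CcSmoothMap.ext fun _ => leibniz_lie _ _ _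

@[simp] theorem CcSmoothMap.lie_apply (f h : CcSmoothMap E M g) (p : M) :
    ⁅f, h⁆ p = ⁅f p, h p⁆ := rfl

instance : LieAlgebra ℝ (CcSmoothMap E M g) where
  lie_smul _ _ _ := map_smul _ _ _

end Lie

/-! ### Universal invariant symmetric bilinear forms -/

section Universal

/-- A (Hausdorff) locally convex space over the reals. -/
structure IsLocallyConvexSpace (V : Type uV) [AddCommGroup V] [Module ℝ V] [TopologicalSpace V] :
    Prop where
  isTopologicalAddGroup : IsTopologicalAddGroup V
  continuousSMul : ContinuousSMul ℝ V
  locallyConvex : LocallyConvexSpace ℝ V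
  t2 : T2Space V

/-- A locally convex Lie algebra: a locally convex space with a continuous Lie bracket. -/
structure IsLocallyConvexLieAlgebra (L : Type uL) [LieRing L] [LieAlgebra ℝ L]
    [TopologicalSpace L] : Prop where
  isLocallyConvexSpace : IsLocallyConvexSpace L
  continuous_lie : Continuous fun p : L × L => ⁅p.1, p.2⁆

variable {L : Type uL} [LieRing L] [LieAlgebra ℝ L] [TopologicalSpace L]
variable {V : Type uV} [AddCommGroup V] [Module ℝ V] [TopologicalSpace V]

/-- Continuous invariant symmetric bilinear forms on `L` with values in a locally convex space.
Continuity is joint continuity on `L × L`. -/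
structure IsContinuousInvariantForm (β : L →ₗ[ℝ] L →ₗ[ℝ] V) : Prop where
  isLocallyConvexSpace : IsLocallyConvexSpace V
  symm : ∀ x y, β x y = β y x
  invariant : ∀ x y z, β ⁅x, y⁆ z = β x ⁅y, z⁆
  continuous : Continuous fun p : L × L => β p.1 p.2

/-- A form `β` on the locally convex Lie algebra `L` is topologically universal if it is a
continuous invariant symmetric bilinear form and every other such form `γ` factors through `β` by
a unique continuous linear map. -/
structure IsTopologicallyUniversal (β : L →ₗ[ℝ] L →ₗ[ℝ] V) : Prop where
  isLocallyConvexLieAlgebra : IsLocallyConvexLieAlgebra L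
  isContinuousInvariantForm : IsContinuousInvariantForm β
  existsUnique : ∀ (W : Type uW) [AddCommGroup W] [Module ℝ W] [TopologicalSpace W]
    (γ : L →ₗ[ℝ] L →ₗ[ℝ] W), IsContinuousInvariantForm γ →
      ∃! ψ : V →L[ℝ] W, ∀ x y, γ x y = ψ (β x y)

end Universal

section Target

variable (g : Type*) [LieRing g] [LieAlgebra ℝ g]

/-- The symmetric square `S²(g)`. -/
abbrev SymSq : Type _ :=
  (g ⊗[ℝ] g) ⧸ Submodule.span ℝ {t : g ⊗[ℝ] g | ∃ x y : g, t = x ⊗ₜ[ℝ] y - y ⊗ₜ[ℝ] x}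

/-- The symmetric product `x ∨ y` in `S²(g)`. -/
def vee : g →ₗ[ℝ] g →ₗ[ℝ] SymSq g :=
  (TensorProduct.mk ℝ g g).compr₂ (Submodule.mkQ _)

/-- The space `V_g`, the quotient of `S²(g)` by the span of all `[x,y] ∨ z - x ∨ [y,z]`. For a
finite-dimensional Lie algebra `g` this subspace is closed, so no closure is needed. -/
abbrev VSpace : Type _ :=
  SymSq g ⧸ Submodule.span ℝ {t : SymSq g | ∃ x y z : g, t = vee g ⁅x, y⁆ z - vee g x ⁅y, z⁆}

/-- The map `κ_g : g × g → V_g`, `(x, y) ↦ [x ∨ y]`. -/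
def kappa : g →ₗ[ℝ] g →ₗ[ℝ] VSpace g :=
  (vee g).compr₂ (Submodule.mkQ _)

end Target

end UnivForm

end

noncomputable section

namespace UnivForm

/-! ### Seminorms on `C^∞(M, V)` and on the inductive limit `C^∞_c(M, V)`. -/

section LocallyConvex

/-! Algebra. Write `a ⊗ x` for `tens a x`. Invariance moves scalar factors across `γ` together with
brackets; since `g` is spanned by brackets, scalar factors move on their own (`form_tens_mul`). If
`χ a = a`, it follows that `γ(a ⊗ u, c ⊗ z) = γ(χ² ⊗ u, ac ⊗ z)`, which depends on `c` only through
`ac`. Cut-offs thus stand in for the missing unit, and for fixed `a` the form `(x, y) ↦ γ(a ⊗ x, χ ⊗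
y)` is symmetric and invariant on `g`, hence factors through `κ` (`exists_lift_form_tens`). With a
decomposition `v = ∑ cᵢ(v) κ(xᵢ, yᵢ)` the factorization is forced to be `ψ(F) = ∑ γ((cᵢ ∘ F) ⊗ xᵢ, χ
⊗ yᵢ)`, where `χ = 1` on the support of `F`; the choice of `χ` does not matter
(`exists_linear_eq_sum_form`, `exists_linear_factorization`). The same decomposition of `F` gives
uniqueness. For continuity of `ψ` it suffices to look at maps supported in one compact set, where a
single `χ` serves and the formula is visibly continuous.

Analysis. Joint continuity of pointwise products on `C^∞_c` does not follow from continuity on each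
step of the inductive limit. In `continuous_pointwise` a continuous seminorm `q` of `β(f, g)` is
split by a locally finite partition of unity `hₙ`. The Leibniz rule gives `q(hₙ β(f, g)) ≤ Rₙ(f)
Sₙ(g)`, where `Rₙ` and `Sₙ` see only jets over the support of `hₙ` (`exists_local_bound`). Locally
finite sums of such seminorms are continuous on `C^∞_c`, however fast their constants grow
(`exists_seminorm_sum_le`), so `q(β(f, g)) ≤ P(f) Q(g)` with `P = ∑ Rₙ` and `Q = ∑ Sₙ`. -/

theorem tsupport_add_subset_of_subset {M V : Type*} [TopologicalSpace M] [AddCommGroup V]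
    {K : Set M} {f g : M → V} (hf : tsupport f ⊆ K)
    (hg : tsupport g ⊆ K) : tsupport (f + g) ⊆ K :=
  (tsupport_add f g).trans (Set.union_subset hf hg)

theorem tsupport_smul_subset_of_subset {M V : Type*} [TopologicalSpace M] [AddCommGroup V]
    [Module ℝ V] {K : Set M} {f : M → V} (c : ℝ) (hf : tsupport f ⊆ K) :
    tsupport (c • f) ⊆ K :=
  (closure_mono (Function.support_const_smul_subset c f)).trans hf

theorem iteratedFDeriv_localRep_eq_zero {E M V : Type*} [NormedAddCommGroup E]
    [NormedSpace ℝ E] [TopologicalSpace M] [AddCommGroup V] [Module ℝ V] [FiniteDimensional ℝ V]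
    {f : M → V} (e : OpenPartialHomeomorph M E) (k : ℕ) {x : E}
    (hx : x ∈ e.target) (hf : e.symm x ∉ tsupport f) :
    iteratedFDeriv ℝ k (localRep f e) x = 0 := by
  have h1 : ∀ᶠ y in 𝓝 x, e.symm y ∈ (tsupport f)ᶜ :=
    (e.continuousAt_symm hx).eventually_mem ((isClosed_tsupport f).isOpen_compl.mem_nhds hf)
  have h2 : localRep f e =ᶠ[𝓝 x] fun _ => 0 := by
    filter_upwards [h1] with y hy
    simp [localRep, image_eq_zero_of_notMem_tsupport hy]
  rw [(h2.iteratedFDeriv ℝ k).self_of_nhds]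
  simp

variable {E : Type*} [NormedAddCommGroup E] [NormedSpace ℝ E]
variable {M : Type*} [TopologicalSpace M] [ChartedSpace E M]
variable {V : Type*} [AddCommGroup V] [Module ℝ V] [FiniteDimensional ℝ V]

/-- The inclusion of `C^∞_c(M, V)` in `C^∞(M, V)`. -/
def CcSmoothMap.toSmooth : CcSmoothMap E M V →ₗ[ℝ] SmoothMap E M V where
  toFun f := ⟨f.1, f.2.1⟩
  map_add' _ _ := rfl
  map_smul' _ _ := rfl

@[simp] theorem CcSmoothMap.coe_toSmooth (f : CcSmoothMap E M V) : ⇑f.toSmooth = f := rfl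

variable [IsManifold 𝓘(ℝ, E) ∞ M]

/-- The seminorm on `C^∞(M, V)` given by the supremum of a derivative over a compact set. -/
def jetSeminorm (i : JetIndex E M) : Seminorm ℝ (SmoothMap E M V) :=
  (normSeminorm ℝ C(i.compact, E [×i.order]→L[ℝ] (Fin (Module.finrank ℝ V) → ℝ))).comp (jet V i)

/-- The factor `Fin 1` is the index set of the single norm on each Banach space of jets. -/
theorem withSeminorms_jetSeminorm :
    WithSeminorms (SeminormFamily.sigma fun (i : JetIndex E M) (_ : Fin 1) =>
      jetSeminorm (V := V) i) := by
  have h (i : JetIndex E M) := (jet V i).withSeminorms_induced (norm_withSeminorms ℝ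
    C(i.compact, E [×i.order]→L[ℝ] (Fin (Module.finrank ℝ V) → ℝ)))
  exact withSeminorms_iInf h

instance : IsTopologicalAddGroup (SmoothMap E M V) :=
  withSeminorms_jetSeminorm.topologicalAddGroup

theorem continuous_jetSeminorm (i : JetIndex E M) : Continuous (jetSeminorm (V := V) i) :=
  withSeminorms_jetSeminorm.continuous_seminorm ⟨i, 0⟩

theorem jetSeminorm_le {i : JetIndex E M} {f : SmoothMap E M V} {C : ℝ} (hC : 0 ≤ C)
    (h : ∀ x ∈ i.compact, ‖iteratedFDeriv ℝ i.order (localRep f i.chart) x‖ ≤ C) :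
    jetSeminorm i f ≤ C :=
  (ContinuousMap.norm_le (jet V i f) hC).2 fun x => h x x.2

theorem norm_iteratedFDeriv_le_jetSeminorm (i : JetIndex E M) (f : SmoothMap E M V) {x : E}
    (hx : x ∈ i.compact) :
    ‖iteratedFDeriv ℝ i.order (localRep f i.chart) x‖ ≤ jetSeminorm i f :=
  ContinuousMap.norm_coe_le_norm (jet V i f) ⟨x, hx⟩

theorem jetSeminorm_eq_zero {i : JetIndex E M} {f : SmoothMap E M V}
    (h : ∀ x ∈ i.compact, i.chart.symm x ∉ tsupport f) : jetSeminorm i f = 0 := by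
  refine le_antisymm (jetSeminorm_le le_rfl fun x hx => ?_) (apply_nonneg _ _)
  rw [iteratedFDeriv_localRep_eq_zero _ _ (i.compact_subset hx) (h x hx), norm_zero]

/-- The part of the compact set of a jet index that lies in the closed set `K`. -/
def JetIndex.restrict (i : JetIndex E M) {K : Set M} (hK : IsClosed K) : JetIndex E M where
  chart := i.chart
  chart_mem := i.chart_mem
  compact := ⟨i.compact ∩ i.chart.symm ⁻¹' K, i.compact.isCompact.of_isClosed_subset
    ((i.chart.continuousOn_symm.mono i.compact_subset).preimage_isClosed_of_isClosed
      i.compact.isCompact.isClosed hK) Set.inter_subset_left⟩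
  compact_subset := Set.inter_subset_left.trans i.compact_subset
  order := i.order

theorem jetSeminorm_le_restrict (i : JetIndex E M) {K : Set M} (hK : IsClosed K)
    {f : SmoothMap E M V} (hf : tsupport f ⊆ K) :
    jetSeminorm i f ≤ jetSeminorm (i.restrict hK) f := by
  refine jetSeminorm_le (apply_nonneg _ _) fun x hx => ?_
  by_cases h : i.chart.symm x ∈ K
  · exact norm_iteratedFDeriv_le_jetSeminorm (i.restrict hK) f ⟨hx, h⟩
  · rw [iteratedFDeriv_localRep_eq_zero _ _ (i.compact_subset hx) fun h' => h (hf h'), norm_zero]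
    exact apply_nonneg _ _

variable [T2Space M]

instance : IsTopologicalAddGroup (CcSmoothMap E M V) :=
  topologicalAddGroup_sInf fun _ ht => ht.2.1

instance : ContinuousSMul ℝ (CcSmoothMap E M V) :=
  continuousSMul_sInf fun _ ht => ht.2.2.1

instance : LocallyConvexSpace ℝ (CcSmoothMap E M V) :=
  LocallyConvexSpace.sInf fun _ ht => ht.2.2.2

theorem continuous_toCc {K : Set M} (hK : IsCompact K) :
    Continuous (SmoothMapOn.toCc (E := E) (V := V) hK) :=
  continuous_sInf_rng.2 fun _ ht => ht.1 K hK

theorem CcSmoothMap.continuous_of_toCc {W : Type*} [AddCommGroup W] [Module ℝ W]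
    [TopologicalSpace W] [IsTopologicalAddGroup W] [ContinuousSMul ℝ W] [LocallyConvexSpace ℝ W]
    (T : CcSmoothMap E M V →ₗ[ℝ] W)
    (h : ∀ (K : Set M) (hK : IsCompact K), Continuous fun f : SmoothMapOn E V K => T (f.toCc hK)) :
    Continuous T :=
  continuous_iff_le_induced.2 <| sInf_le
    ⟨fun K hK => continuous_induced_rng.2 (h K hK), topologicalAddGroup_induced T,
      continuousSMul_induced T, LocallyConvexSpace.induced T⟩

/-- The topology defined by `P` alone is a locally convex vector topology. The bounds make the
inclusions of all `C^∞_K(M, V)` continuous for it, so it is one of the topologies in the infimum and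
is coarser than the inductive limit topology. -/
theorem CcSmoothMap.continuous_seminorm_of_le (P : Seminorm ℝ (CcSmoothMap E M V))
    (h : ∀ K : Set M, IsCompact K → ∃ p : Seminorm ℝ (SmoothMap E M V), Continuous p ∧
      ∀ f : CcSmoothMap E M V, tsupport f ⊆ K → P f ≤ p f.toSmooth) :
    Continuous P := by
  let p : SeminormFamily ℝ (CcSmoothMap E M V) Unit := fun _ => P
  let t : TopologicalSpace (CcSmoothMap E M V) := p.moduleFilterBasis.topology
  have ht : @WithSeminorms ℝ (CcSmoothMap E M V) Unit _ _ _ p t :=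
    @WithSeminorms.mk _ _ _ _ _ _ _ t rfl
  refine continuous_le_dom (sInf_le ⟨fun K hK => ?_,
    @WithSeminorms.topologicalAddGroup _ _ _ _ _ _ t _ ht,
    @WithSeminorms.continuousSMul _ _ _ _ _ _ t _ ht,
    @WithSeminorms.toLocallyConvexSpace _ _ _ _ _ _ _ _ _ t _ ht⟩)
    (@WithSeminorms.continuous_seminorm _ _ _ _ _ _ t _ ht ())
  obtain ⟨r, hr, hPr⟩ := h K hK
  refine @continuous_iff_continuousAt _ _ _ t _ |>.2 fun f₀ => ?_
  refine (ht.tendsto_nhds _ _).2 fun _ ε hε => ?_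
  have hcont : Continuous fun f : SmoothMapOn E V K => r (f.1 - f₀.1) :=
    hr.comp (continuous_subtype_val.sub continuous_const)
  have hlt : ∀ᶠ f in 𝓝 f₀, r (f.1 - f₀.1) < ε :=
    hcont.continuousAt.eventually_lt continuousAt_const (by simpa using hε)
  filter_upwards [hlt] with f hf
  refine (hPr (f.toCc hK - f₀.toCc hK) ?_).trans_lt hf
  rw [sub_eq_add_neg, ← neg_one_smul ℝ]
  exact tsupport_add_subset_of_subset f.2 (tsupport_smul_subset_of_subset _ f₀.2)

/-- Continuity of `q` on `C^∞_K(M, V)` bounds it by finitely many jet seminorms. Derivatives vanish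
off the support, so their compact sets may be cut down to `K`; this localization later makes the
bounds vanish on maps supported away from `K`. -/
theorem CcSmoothMap.exists_le_of_continuous_seminorm {q : Seminorm ℝ (CcSmoothMap E M V)}
    (hq : Continuous q) {K : Set M} (hK : IsCompact K) :
    ∃ (s : Finset (JetIndex E M)) (C : ℝ), 0 ≤ C ∧
      (∀ i ∈ s, ∀ x ∈ i.compact, i.chart.symm x ∈ K) ∧
      ∀ f : CcSmoothMap E M V, tsupport f ⊆ K → q f ≤ C * ∑ i ∈ s, jetSeminorm i f.toSmooth := by
  classical
  let S : Submodule ℝ (SmoothMap E M V) :=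
    { carrier := {f | tsupport f ⊆ K}
      zero_mem' := by
        change tsupport (0 : M → V) ⊆ K
        simp
      add_mem' := fun hf hg => tsupport_add_subset_of_subset hf hg
      smul_mem' := fun c _ hf => tsupport_smul_subset_of_subset c hf }
  let J : S →ₗ[ℝ] CcSmoothMap E M V :=
    { toFun := fun f => SmoothMapOn.toCc hK ⟨f.1, f.2⟩
      map_add' := fun _ _ => rfl
      map_smul' := fun _ _ => rfl }
  have hJ : Continuous J :=
    (continuous_toCc hK).comp (continuous_subtype_val.subtype_mk _)
  obtain ⟨s, C, -, hC⟩ := Seminorm.bound_of_continuous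
    (S.subtype.withSeminorms_induced (withSeminorms_jetSeminorm (E := E) (M := M) (V := V)))
    (q.comp J) (hq.comp hJ)
  let r : ((_ : JetIndex E M) × Fin 1) → JetIndex E M := fun j => j.1.restrict hK.isClosed
  refine ⟨s.image r, C, C.2, ?_, fun f hf => ?_⟩
  · intro i hi
    obtain ⟨j, -, rfl⟩ := Finset.mem_image.1 hi
    exact fun x hx => hx.2
  · have h1 := hC ⟨f.toSmooth, hf⟩
    refine h1.trans ?_
    change (C : ℝ) * _ ≤ _
    refine mul_le_mul_of_nonneg_left ?_ C.2
    refine Seminorm.finset_sup_apply_le (Finset.sum_nonneg fun _ _ => apply_nonneg _ _) ?_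
    intro j hj
    have h2 : r j ∈ s.image r := Finset.mem_image_of_mem r hj
    have h3 : jetSeminorm (r j) f.toSmooth ≤ ∑ i ∈ s.image r, jetSeminorm i f.toSmooth :=
      Finset.single_le_sum (f := fun i => jetSeminorm i f.toSmooth)
        (fun _ _ => apply_nonneg _ _) h2
    exact (jetSeminorm_le_restrict (f := f.toSmooth) j.1 hK.isClosed hf).trans h3

end LocallyConvex

/-! ### A seminorm criterion for joint continuity of bilinear maps. -/

section Seminorms

theorem continuous_bilin_of_seminorm_le {X Y Z : Type*} [AddCommGroup X] [Module ℝ X]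
    [TopologicalSpace X] [IsTopologicalAddGroup X] [AddCommGroup Y] [Module ℝ Y]
    [TopologicalSpace Y] [IsTopologicalAddGroup Y] [AddCommGroup Z] [Module ℝ Z]
    [TopologicalSpace Z] [PolynormableSpace ℝ Z] (B : X →ₗ[ℝ] Y →ₗ[ℝ] Z)
    (h : ∀ q : Seminorm ℝ Z, Continuous q → ∃ (P : Seminorm ℝ X) (Q : Seminorm ℝ Y),
      Continuous P ∧ Continuous Q ∧ ∀ x y, q (B x y) ≤ P x * Q y) :
    Continuous fun p : X × Y => B p.1 p.2 := by
  refine continuous_iff_continuousAt.2 fun ⟨x₀, y₀⟩ => ?_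
  refine ((PolynormableSpace.withSeminorms ℝ Z).tendsto_nhds _ _).2 fun ⟨q, hq⟩ ε hε => ?_
  obtain ⟨P, Q, hP, hQ, hle⟩ := h q hq
  have hcont : Continuous fun p : X × Y => P (p.1 - x₀) * Q p.2 + P x₀ * Q (p.2 - y₀) :=
    ((hP.comp (continuous_fst.sub continuous_const)).mul (hQ.comp continuous_snd)).add
      (continuous_const.mul (hQ.comp (continuous_snd.sub continuous_const)))
  have hlt : ∀ᶠ p in 𝓝 (x₀, y₀), P (p.1 - x₀) * Q p.2 + P x₀ * Q (p.2 - y₀) < ε :=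
    hcont.continuousAt.eventually_lt continuousAt_const (by simpa using hε)
  filter_upwards [hlt] with p hp
  have heq : B p.1 p.2 - B x₀ y₀ = B (p.1 - x₀) p.2 + B x₀ (p.2 - y₀) := by
    simp
  change q (B p.1 p.2 - B x₀ y₀) < ε
  rw [heq]
  exact (map_add_le_add q _ _).trans_lt ((add_le_add (hle _ _) (hle _ _)).trans_lt hp)

theorem seminorm_sum_apply {ι X : Type*} [AddCommGroup X] [Module ℝ X] (s : Finset ι)
    (p : ι → Seminorm ℝ X) (x : X) : (∑ i ∈ s, p i) x = ∑ i ∈ s, p i x := by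
  simp

end Seminorms

/-! ### Joint continuity of pointwise bilinear maps. -/

section Pointwise

variable {E : Type*} [NormedAddCommGroup E] [NormedSpace ℝ E]
variable {M : Type*} [TopologicalSpace M] [ChartedSpace E M]
variable {V : Type*} [AddCommGroup V] [Module ℝ V] [FiniteDimensional ℝ V]
variable {W : Type*} [AddCommGroup W] [Module ℝ W] [FiniteDimensional ℝ W]
variable {U : Type*} [AddCommGroup U] [Module ℝ U] [FiniteDimensional ℝ U]

/-- The jet index with the same chart and compact set and another order of differentiation. -/
def JetIndex.withOrder (i : JetIndex E M) (k : ℕ) : JetIndex E M := { i with order := k }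

/-- A single `B` serves all maps and all charts, so the Leibniz constants do not depend on `f` and
`g`. -/
theorem exists_localRep_pointwise (β : V →ₗ[ℝ] W →ₗ[ℝ] U) :
    ∃ B : (Fin (Module.finrank ℝ V) → ℝ) →L[ℝ] (Fin (Module.finrank ℝ W) → ℝ) →L[ℝ]
      (Fin (Module.finrank ℝ U) → ℝ), ∀ (f : CcSmoothMap E M V) (g : CcSmoothMap E M W)
      (e : OpenPartialHomeomorph M E), localRep (pointwise β f g) e =
        fun x => B (localRep f e x) (localRep g e x) := by
  let B : (Fin (Module.finrank ℝ V) → ℝ) →ₗ[ℝ] (Fin (Module.finrank ℝ W) → ℝ) →ₗ[ℝ]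
      (Fin (Module.finrank ℝ U) → ℝ) :=
    (β.compl₁₂ (coords V).symm.toLinearMap (coords W).symm.toLinearMap).compr₂
      (coords U).toLinearMap
  refine ⟨LinearMap.toContinuousLinearMap
    ((LinearMap.toContinuousLinearMap (𝕜 := ℝ) (E := Fin (Module.finrank ℝ W) → ℝ)
      (F' := Fin (Module.finrank ℝ U) → ℝ)).toLinearMap ∘ₗ B), fun f g e => funext fun x => ?_⟩
  simp [B, localRep]

theorem tsupport_pointwise_subset_left (β : V →ₗ[ℝ] W →ₗ[ℝ] U) (f : CcSmoothMap E M V)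
    (g : CcSmoothMap E M W) : tsupport (pointwise β f g) ⊆ tsupport f :=
  closure_mono fun p hp h0 => hp (by simp [Function.notMem_support.1 (not_not.2 h0)])

variable [IsManifold 𝓘(ℝ, E) ∞ M]

/-- The sum of the suprema over a compact set of all derivatives up to some order. -/
def jetSumSeminorm (i : JetIndex E M) : Seminorm ℝ (SmoothMap E M V) :=
  ∑ k ∈ Finset.range (i.order + 1), jetSeminorm (i.withOrder k)

theorem jetSumSeminorm_apply (i : JetIndex E M) (f : SmoothMap E M V) :
    jetSumSeminorm i f = ∑ k ∈ Finset.range (i.order + 1), jetSeminorm (i.withOrder k) f :=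
  seminorm_sum_apply _ _ _

theorem continuous_jetSumSeminorm (i : JetIndex E M) : Continuous (jetSumSeminorm (V := V) i) :=
  Seminorm.continuous_finsetSum fun _ _ => continuous_jetSeminorm _

theorem jetSumSeminorm_eq_zero {i : JetIndex E M} {f : SmoothMap E M V}
    (h : ∀ x ∈ i.compact, i.chart.symm x ∉ tsupport f) : jetSumSeminorm i f = 0 := by
  rw [jetSumSeminorm_apply]
  exact Finset.sum_eq_zero fun k _ => jetSeminorm_eq_zero (i := i.withOrder k) h

theorem jetSeminorm_withOrder_le_jetSumSeminorm (i : JetIndex E M) (f : SmoothMap E M V) {k : ℕ}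
    (hk : k ≤ i.order) : jetSeminorm (i.withOrder k) f ≤ jetSumSeminorm i f := by
  rw [jetSumSeminorm_apply]
  exact Finset.single_le_sum (f := fun k => jetSeminorm (i.withOrder k) f)
    (fun _ _ => apply_nonneg _ _) (Finset.mem_range.2 (Nat.lt_succ_of_le hk))

theorem jetSeminorm_le_jetSumSeminorm (i : JetIndex E M) (f : SmoothMap E M V) :
    jetSeminorm i f ≤ jetSumSeminorm i f :=
  jetSeminorm_withOrder_le_jetSumSeminorm i f le_rfl

/-- This is the Leibniz rule; the binomial coefficients and `‖B‖` make up the constant. Derivatives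
are taken within the open chart target, where the local representatives are known to be smooth. -/
theorem exists_jetSeminorm_pointwise_le (β : V →ₗ[ℝ] W →ₗ[ℝ] U) (i : JetIndex E M) :
    ∃ C : ℝ, 0 ≤ C ∧ ∀ (f : CcSmoothMap E M V) (g : CcSmoothMap E M W),
      jetSeminorm i (pointwise β f g).toSmooth ≤
        C * jetSumSeminorm i f.toSmooth * jetSumSeminorm i g.toSmooth := by
  obtain ⟨B, hB⟩ := exists_localRep_pointwise (E := E) (M := M) β
  refine ⟨‖B‖ * ∑ k ∈ Finset.range (i.order + 1), (i.order.choose k : ℝ), by positivity,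
    fun f g => jetSeminorm_le (by positivity) fun x hx => ?_⟩
  have hxt := i.compact_subset hx
  have hu := i.chart.open_target.uniqueDiffOn (𝕜 := ℝ)
  have h1 := B.norm_iteratedFDerivWithin_le_of_bilinear
    (contDiffOn_localRep f.isSmooth i.chart_mem) (contDiffOn_localRep g.isSmooth i.chart_mem)
    hu hxt (n := i.order) (by exact_mod_cast le_top)
  rw [CcSmoothMap.coe_toSmooth, hB, ← iteratedFDerivWithin_of_isOpen _ i.chart.open_target hxt]
  refine h1.trans ?_
  rw [mul_assoc, mul_assoc, Finset.sum_mul]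
  refine mul_le_mul_of_nonneg_left (Finset.sum_le_sum fun k hk => ?_) (norm_nonneg B)
  have hk' : k ≤ i.order := Nat.lt_succ_iff.1 (Finset.mem_range.1 hk)
  rw [iteratedFDerivWithin_of_isOpen _ i.chart.open_target hxt,
    iteratedFDerivWithin_of_isOpen _ i.chart.open_target hxt, mul_assoc]
  refine mul_le_mul_of_nonneg_left (mul_le_mul ?_ ?_ (norm_nonneg _) (apply_nonneg _ _))
    (Nat.cast_nonneg _)
  · exact (norm_iteratedFDeriv_le_jetSeminorm (i.withOrder k) f.toSmooth hx).trans
      (jetSeminorm_withOrder_le_jetSumSeminorm i _ hk')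
  · exact (norm_iteratedFDeriv_le_jetSeminorm (i.withOrder (i.order - k)) g.toSmooth hx).trans
      (jetSeminorm_withOrder_le_jetSumSeminorm i _ (Nat.sub_le _ _))

theorem jetSumSeminorm_withOrder_le (i : JetIndex E M) (f : SmoothMap E M V) {k : ℕ}
    (hk : k ≤ i.order) : jetSumSeminorm (i.withOrder k) f ≤ jetSumSeminorm i f := by
  rw [jetSumSeminorm_apply, jetSumSeminorm_apply]
  exact Finset.sum_le_sum_of_subset_of_nonneg
    (Finset.range_mono (Nat.succ_le_succ hk)) fun _ _ _ => apply_nonneg _ _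

/-- Having the same kind of seminorm on both sides allows the estimate to be iterated for triple
products. -/
theorem exists_jetSumSeminorm_pointwise_le (β : V →ₗ[ℝ] W →ₗ[ℝ] U) (i : JetIndex E M) :
    ∃ C : ℝ, 0 ≤ C ∧ ∀ (f : CcSmoothMap E M V) (g : CcSmoothMap E M W),
      jetSumSeminorm i (pointwise β f g).toSmooth ≤
        C * jetSumSeminorm i f.toSmooth * jetSumSeminorm i g.toSmooth := by
  choose C hC hle using fun k => exists_jetSeminorm_pointwise_le β (i.withOrder k)
  refine ⟨∑ k ∈ Finset.range (i.order + 1), C k, Finset.sum_nonneg fun k _ => hC k, fun f g => ?_⟩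
  rw [jetSumSeminorm_apply, Finset.sum_mul, Finset.sum_mul]
  refine Finset.sum_le_sum fun k hk => (hle k f g).trans ?_
  have hk' : k ≤ i.order := Nat.lt_succ_iff.1 (Finset.mem_range.1 hk)
  exact mul_le_mul (mul_le_mul_of_nonneg_left (jetSumSeminorm_withOrder_le i _ hk') (hC k))
    (jetSumSeminorm_withOrder_le i _ hk') (apply_nonneg _ _)
    (mul_nonneg (hC k) (apply_nonneg _ _))

variable [T2Space M]

theorem exists_local_bound (β : V →ₗ[ℝ] W →ₗ[ℝ] U) {q : Seminorm ℝ (CcSmoothMap E M U)}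
    (hq : Continuous q) (h : CcSmoothMap E M ℝ) :
    ∃ (R : Seminorm ℝ (SmoothMap E M V)) (S : Seminorm ℝ (SmoothMap E M W)),
      Continuous R ∧ Continuous S ∧
      (∀ f : SmoothMap E M V, Disjoint (tsupport h) (tsupport f) → R f = 0) ∧
      (∀ f : SmoothMap E M W, Disjoint (tsupport h) (tsupport f) → S f = 0) ∧
      ∀ (f : CcSmoothMap E M V) (g : CcSmoothMap E M W),
        q (pointwise (LinearMap.lsmul ℝ U) h (pointwise β f g)) ≤ R f.toSmooth * S g.toSmooth := by
  obtain ⟨s, C, hC, hs, hle⟩ :=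
    CcSmoothMap.exists_le_of_continuous_seminorm hq h.hasCompactSupport
  choose C₁ hC₁ hle₁ using
    fun i : JetIndex E M => exists_jetSumSeminorm_pointwise_le (LinearMap.lsmul ℝ U) i
  choose C₂ hC₂ hle₂ using fun i : JetIndex E M => exists_jetSumSeminorm_pointwise_le β i
  -- The function `h` is fixed, so its jets and both Leibniz constants are absorbed into the weights
  -- of `R`.
  let c : JetIndex E M → NNReal := fun i =>
    ⟨C * (C₁ i * jetSumSeminorm i h.toSmooth * C₂ i), mul_nonneg hC
      (mul_nonneg (mul_nonneg (hC₁ i) (apply_nonneg _ _)) (hC₂ i))⟩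
  refine ⟨∑ i ∈ s, c i • jetSumSeminorm i, ∑ i ∈ s, jetSumSeminorm i,
    Seminorm.continuous_finsetSum fun i _ => (continuous_jetSumSeminorm i).const_smul (c i),
    Seminorm.continuous_finsetSum fun i _ => continuous_jetSumSeminorm i, ?_, ?_, ?_⟩
  · intro f hf
    rw [seminorm_sum_apply]
    refine Finset.sum_eq_zero fun i hi => ?_
    rw [smul_apply, jetSumSeminorm_eq_zero fun x hx => Set.disjoint_left.1 hf (hs i hi x hx),
      smul_zero]
  · intro f hf
    rw [seminorm_sum_apply]
    exact Finset.sum_eq_zero fun i hi =>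
      jetSumSeminorm_eq_zero fun x hx => Set.disjoint_left.1 hf (hs i hi x hx)
  · intro f g
    refine (hle _ (tsupport_pointwise_subset_left _ _ _)).trans ?_
    rw [seminorm_sum_apply, seminorm_sum_apply, Finset.sum_mul, Finset.mul_sum]
    refine Finset.sum_le_sum fun i hi => ?_
    have h1 : jetSeminorm i (pointwise (LinearMap.lsmul ℝ U) h (pointwise β f g)).toSmooth ≤
        C₁ i * jetSumSeminorm i h.toSmooth *
          (C₂ i * jetSumSeminorm i f.toSmooth * jetSumSeminorm i g.toSmooth) :=
      (jetSeminorm_le_jetSumSeminorm i _).trans ((hle₁ i _ _).trans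
        (mul_le_mul_of_nonneg_left (hle₂ i f g) (mul_nonneg (hC₁ i) (apply_nonneg _ _))))
    have h2 : jetSumSeminorm i g.toSmooth ≤ ∑ j ∈ s, jetSumSeminorm j g.toSmooth :=
      Finset.single_le_sum (f := fun j => jetSumSeminorm j g.toSmooth)
        (fun _ _ => apply_nonneg _ _) hi
    calc _ ≤ _ := mul_le_mul_of_nonneg_left h1 hC
      _ = (c i • jetSumSeminorm i f.toSmooth) * jetSumSeminorm i g.toSmooth := by
        change _ = (C * (C₁ i * jetSumSeminorm i h.toSmooth * C₂ i)) *
          jetSumSeminorm i f.toSmooth * _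
        ring
      _ ≤ _ := mul_le_mul_of_nonneg_left h2 (apply_nonneg (c i • jetSumSeminorm i) _)

/-- Only finitely many `K n` meet a given compact set, so on each `C^∞_K(M, V)` the infinite sum is
a finite sum of continuous seminorms. -/
theorem exists_seminorm_sum_le {ι : Type*} {K : ι → Set M} (hK : LocallyFinite K)
    (R : ι → Seminorm ℝ (SmoothMap E M V)) (hR : ∀ n, Continuous (R n))
    (hR0 : ∀ n (f : SmoothMap E M V), Disjoint (K n) (tsupport f) → R n f = 0) :
    ∃ P : Seminorm ℝ (CcSmoothMap E M V), Continuous P ∧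
      ∀ (f : CcSmoothMap E M V) (T : Finset ι), ∑ n ∈ T, R n f.toSmooth ≤ P f := by
  classical
  have hfin (L : Set M) (hL : IsCompact L) := hK.finite_nonempty_inter_compact hL
  have hzero (f : CcSmoothMap E M V) {L : Set M} (hL : IsCompact L) (hf : tsupport f ⊆ L) (n : ι)
      (hn : n ∉ (hfin L hL).toFinset) : R n f.toSmooth = 0 := by
    refine hR0 n _ (Set.disjoint_iff_inter_eq_empty.2 ?_)
    by_contra hne
    obtain ⟨p, hp, hp'⟩ := Set.nonempty_iff_ne_empty.2 hne
    exact hn ((hfin L hL).mem_toFinset.2 ⟨p, hp, hf hp'⟩)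
  have hsum (f : CcSmoothMap E M V) {L : Set M} (hL : IsCompact L) (hf : tsupport f ⊆ L) :
      ∑ᶠ n, R n f.toSmooth = ∑ n ∈ (hfin L hL).toFinset, R n f.toSmooth := by
    refine finsum_eq_sum_of_support_subset _ fun n hn => ?_
    by_contra hn'
    exact hn (hzero f hL hf n hn')
  -- The default value `0` of `∑ᶠ` is harmless: by `hsum` the support is finite for every compactly
  -- supported `f`.
  let P : Seminorm ℝ (CcSmoothMap E M V) := Seminorm.of (fun f => ∑ᶠ n, R n f.toSmooth)
    (fun f g => by
      have hL := f.hasCompactSupport.isCompact.union g.hasCompactSupport.isCompact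
      rw [hsum f hL Set.subset_union_left, hsum g hL Set.subset_union_right,
        hsum (f + g) hL (tsupport_add f g), ← Finset.sum_add_distrib]
      exact Finset.sum_le_sum fun n _ => map_add_le_add (R n) f.toSmooth g.toSmooth)
    (fun c f => by
      have hL := f.hasCompactSupport.isCompact
      rw [hsum f hL subset_rfl, hsum (c • f) hL (tsupport_smul_subset_of_subset c subset_rfl),
        Finset.mul_sum]
      exact Finset.sum_congr rfl fun n _ => map_smul_eq_mul (R n) c f.toSmooth)
  have hP (f : CcSmoothMap E M V) : P f = ∑ᶠ n, R n f.toSmooth := rfl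
  refine ⟨P, CcSmoothMap.continuous_seminorm_of_le P fun L hL =>
    ⟨∑ n ∈ (hfin L hL).toFinset, R n, Seminorm.continuous_finsetSum fun n _ => hR n,
      fun f hf => ?_⟩, fun f T => ?_⟩
  · rw [hP, hsum f hL hf, seminorm_sum_apply]
  · have hL := f.hasCompactSupport.isCompact
    rw [hP, hsum f hL subset_rfl, ← Finset.sum_inter_add_sum_sdiff T (hfin _ hL).toFinset]
    rw [Finset.sum_eq_zero (s := T \ _) fun n hn =>
      hzero f hL subset_rfl n (Finset.mem_sdiff.1 hn).2, add_zero]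
    exact Finset.sum_le_sum_of_subset_of_nonneg Finset.inter_subset_right
      fun _ _ _ => apply_nonneg _ _

theorem exists_compactlySupported_partition (E M : Type*) [NormedAddCommGroup E] [NormedSpace ℝ E]
    [FiniteDimensional ℝ E] [TopologicalSpace M] [ChartedSpace E M] [IsManifold 𝓘(ℝ, E) ∞ M]
    [T2Space M] [SigmaCompactSpace M] :
    ∃ h : M → CcSmoothMap E M ℝ, LocallyFinite (fun n => tsupport (h n)) ∧
      ∀ (p : M) (T : Finset M), (∀ n, h n p ≠ 0 → n ∈ T) → ∑ n ∈ T, h n p = 1 := by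
  have : LocallyCompactSpace M := ChartedSpace.locallyCompactSpace E M
  choose L hL hLn using fun p : M => exists_compact_mem_nhds p
  obtain ⟨ρ, hρ⟩ := SmoothPartitionOfUnity.exists_isSubordinate 𝓘(ℝ, E) (isClosed_univ (X := M))
    (fun p => interior (L p)) (fun _ => isOpen_interior)
    fun p _ => Set.mem_iUnion.2 ⟨p, mem_interior_iff_mem_nhds.2 (hLn p)⟩
  refine ⟨fun n => ⟨ρ n, isSmooth_iff_contMDiff.2 (ρ n).contMDiff,
    HasCompactSupport.of_support_subset_isCompact (hL n)
      ((subset_tsupport _).trans ((hρ n).trans interior_subset))⟩, ?_, fun p T hT => ?_⟩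
  · exact ρ.locallyFinite.closure
  · exact ρ.sum_finsupport' p (Set.mem_univ p) fun n hn => hT n ((ρ.mem_finsupport p).1 hn)

variable [FiniteDimensional ℝ E] [SigmaCompactSpace M]

theorem continuous_pointwise (β : V →ₗ[ℝ] W →ₗ[ℝ] U) :
    Continuous fun p : CcSmoothMap E M V × CcSmoothMap E M W => pointwise β p.1 p.2 := by
  classical
  obtain ⟨h, hfin, hsum⟩ := exists_compactlySupported_partition E M
  refine continuous_bilin_of_seminorm_le (pointwise β) fun q hq => ?_
  choose R S hR hS hR0 hS0 hle using fun n => exists_local_bound β hq (h n)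
  obtain ⟨P, hP, hPle⟩ := exists_seminorm_sum_le hfin R hR hR0
  obtain ⟨Q, hQ, hQle⟩ := exists_seminorm_sum_le hfin S hS hS0
  refine ⟨P, Q, hP, hQ, fun f g => ?_⟩
  let u := pointwise β f g
  have hT := hfin.finite_nonempty_inter_compact u.hasCompactSupport.isCompact
  -- Only the indices whose supports meet that of `u` are needed; the remaining terms vanish.
  have hu : u = ∑ n ∈ hT.toFinset, pointwise (LinearMap.lsmul ℝ U) (h n) u := by
    have hsa (T : Finset M) (p : M) : (∑ n ∈ T, pointwise (LinearMap.lsmul ℝ U) (h n) u) p =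
        ∑ n ∈ T, h n p • u p := by
      induction T using Finset.induction_on with
      | empty => simp
      | insert a T ha ih => simp [Finset.sum_insert ha, ih]
    ext p
    rw [hsa, ← Finset.sum_smul]
    by_cases hp : u p = 0
    · simp [hp]
    · rw [hsum p, one_smul]
      intro n hn
      exact hT.mem_toFinset.2 ⟨p, subset_tsupport _ hn, subset_tsupport _ hp⟩
  change q u ≤ _
  rw [hu]
  calc _ ≤ ∑ n ∈ hT.toFinset, q (pointwise (LinearMap.lsmul ℝ U) (h n) u) :=
        Finset.le_sum_of_subadditive q (map_zero q).le (map_add_le_add q) _ _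
    _ ≤ ∑ n ∈ hT.toFinset, R n f.toSmooth * Q g := by
        refine Finset.sum_le_sum fun n _ => (hle n f g).trans ?_
        refine mul_le_mul_of_nonneg_left ?_ (apply_nonneg _ _)
        simpa using hQle g {n}
    _ = (∑ n ∈ hT.toFinset, R n f.toSmooth) * Q g := (Finset.sum_mul _ _ _).symm
    _ ≤ P f * Q g := mul_le_mul_of_nonneg_right (hPle f _) (apply_nonneg _ _)

end Pointwise

/-! ### Elementary tensors, point evaluations and cut-off functions. -/

section Functions

variable {E : Type*} [NormedAddCommGroup E] [NormedSpace ℝ E]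
variable {M : Type*} [TopologicalSpace M] [ChartedSpace E M]
variable {V : Type*} [AddCommGroup V] [Module ℝ V] [FiniteDimensional ℝ V]
variable {W : Type*} [AddCommGroup W] [Module ℝ W] [FiniteDimensional ℝ W]

theorem IsSmooth.const (v : V) : IsSmooth E fun _ : M => v := contMDiff_const

theorem IsSmooth.linear (A : V →ₗ[ℝ] W) {f : M → V} (hf : IsSmooth E f) :
    IsSmooth E fun p => A (f p) := by
  -- The linear map is the bilinear map `(r, v) ↦ r • A v` at the constant function `r = 1`.
  simpa using IsSmooth.bilin ((LinearMap.lsmul ℝ W).compl₂ A) (IsSmooth.const (1 : ℝ)) hf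

/-- Composition of compactly supported smooth maps with a linear map. -/
def CcSmoothMap.comp (A : V →ₗ[ℝ] W) : CcSmoothMap E M V →ₗ[ℝ] CcSmoothMap E M W where
  toFun f := ⟨fun p => A (f p), f.isSmooth.linear A, f.hasCompactSupport.comp_left (map_zero A)⟩
  map_add' _ _ := CcSmoothMap.ext fun _ => map_add A _ _
  map_smul' _ _ := CcSmoothMap.ext fun _ => map_smul A _ _

@[simp] theorem CcSmoothMap.comp_apply (A : V →ₗ[ℝ] W) (f : CcSmoothMap E M V) (p : M) :
    CcSmoothMap.comp A f p = A (f p) := rfl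

/-- The compactly supported smooth map `a ⊗ v : p ↦ a(p) v`. -/
def tens : CcSmoothMap E M ℝ →ₗ[ℝ] V →ₗ[ℝ] CcSmoothMap E M V :=
  LinearMap.mk₂ ℝ (fun a v => CcSmoothMap.comp (LinearMap.toSpanSingleton ℝ V v) a)
    (fun _ _ _ => map_add _ _ _) (fun _ _ _ => map_smul _ _ _)
    (fun _ _ _ => CcSmoothMap.ext fun _ => smul_add _ _ _)
    (fun _ _ _ => CcSmoothMap.ext fun _ => smul_comm _ _ _)

@[simp] theorem tens_apply (a : CcSmoothMap E M ℝ) (v : V) (p : M) : tens a v p = a p • v := rfl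

@[simp] theorem CcSmoothMap.sum_apply {ι : Type*} (s : Finset ι) (f : ι → CcSmoothMap E M V)
    (p : M) : (∑ i ∈ s, f i) p = ∑ i ∈ s, f i p := by
  classical
  induction s using Finset.induction_on with
  | empty => simp
  | insert a T ha ih => simp [Finset.sum_insert ha, ih]

theorem CcSmoothMap.eq_sum_tens {ι : Type*} [Fintype ι] (b : Module.Basis ι ℝ V)
    (f : CcSmoothMap E M V) : f = ∑ i, tens (CcSmoothMap.comp (b.coord i) f) (b i) := by
  ext p
  simp [b.sum_repr]

/-- In general there is no unit, since the constant `1` has compact support only when `M` is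
compact. -/
instance : CommSemigroup (CcSmoothMap E M ℝ) where
  mul a b := pointwise (LinearMap.mul ℝ ℝ) a b
  mul_assoc _ _ _ := CcSmoothMap.ext fun _ => mul_assoc _ _ _
  mul_comm _ _ := CcSmoothMap.ext fun _ => mul_comm _ _

@[simp] theorem CcSmoothMap.mul_apply (a b : CcSmoothMap E M ℝ) (p : M) :
    (a * b) p = a p * b p := rfl

variable [IsManifold 𝓘(ℝ, E) ∞ M] [T2Space M]

theorem CcSmoothMap.continuous_eval (p : M) :
    Continuous fun f : CcSmoothMap E M V => coords V (f p) := by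
  let T : CcSmoothMap E M V →ₗ[ℝ] (Fin (Module.finrank ℝ V) → ℝ) :=
    { toFun := fun f => coords V (f p)
      map_add' := fun _ _ => map_add (coords V) _ _
      map_smul' := fun _ _ => map_smul (coords V) _ _ }
  let e := chartAt E p
  -- The jet of order zero over the single point `e p` recovers the value at `p`.
  let i : JetIndex E M :=
    { chart := e
      chart_mem := chart_mem_atlas E p
      compact := ⟨{e p}, isCompact_singleton⟩
      compact_subset := Set.singleton_subset_iff.2 (mem_chart_target E p)
      order := 0 }
  let q : Seminorm ℝ (CcSmoothMap E M V) :=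
    (normSeminorm ℝ (Fin (Module.finrank ℝ V) → ℝ)).comp T
  have hq : Continuous q := by
    refine CcSmoothMap.continuous_seminorm_of_le q fun K _ =>
      ⟨jetSeminorm i, continuous_jetSeminorm i, fun f _ => ?_⟩
    have h := norm_iteratedFDeriv_le_jetSeminorm i f.toSmooth (x := e p) rfl
    have h0 : ‖iteratedFDeriv ℝ 0 (localRep f.toSmooth e) (e p)‖ = q f := by
      rw [norm_iteratedFDeriv_zero]
      change ‖coords V (f (e.symm (e p)))‖ = ‖coords V (f p)‖
      rw [e.left_inv (mem_chart_source E p)]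
    exact h0.symm.le.trans h
  exact WithSeminorms.continuous_of_continuous_comp
    (norm_withSeminorms ℝ (Fin (Module.finrank ℝ V) → ℝ)) T fun _ => hq

theorem CcSmoothMap.isLocallyConvexSpace : IsLocallyConvexSpace (CcSmoothMap E M V) where
  isTopologicalAddGroup := inferInstance
  continuousSMul := inferInstance
  locallyConvex := inferInstance
  t2 := by
    refine T2Space.of_injective_continuous
      (f := fun (f : CcSmoothMap E M V) (p : M) => coords V (f p)) (fun f h hfh => ?_)
      (continuous_pi CcSmoothMap.continuous_eval)
    exact CcSmoothMap.ext fun p => (coords V).injective (congrFun hfh p)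

theorem exists_cutoff (E : Type*) {M : Type*} [NormedAddCommGroup E] [NormedSpace ℝ E]
    [FiniteDimensional ℝ E] [TopologicalSpace M] [ChartedSpace E M] [IsManifold 𝓘(ℝ, E) ∞ M]
    [T2Space M] [SigmaCompactSpace M] {K : Set M} (hK : IsCompact K) :
    ∃ χ : CcSmoothMap E M ℝ, ∀ p ∈ K, χ p = 1 := by
  have : LocallyCompactSpace M := ChartedSpace.locallyCompactSpace E M
  obtain ⟨L, hL, hKL⟩ := exists_compact_superset hK
  obtain ⟨f, hf0, hf1, -⟩ := exists_contMDiffMap_zero_one_of_isClosed (n := (⊤ : ℕ∞)) 𝓘(ℝ, E)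
    isOpen_interior.isClosed_compl hK.isClosed
    (Set.disjoint_left.2 fun p hp hpK => hp (hKL hpK))
  refine ⟨⟨f, isSmooth_iff_contMDiff.2 f.contMDiff,
    HasCompactSupport.of_support_subset_isCompact hL fun p hp => interior_subset ?_⟩,
    fun p hp => hf1 hp⟩
  by_contra hpL
  exact hp (hf0 hpL)

end Functions

/-! ### The universal property of `κ` for the finite-dimensional algebra. -/

section Target

variable {g : Type*} [LieRing g] [LieAlgebra ℝ g]

theorem kappa_symm (x y : g) : kappa g x y = kappa g y x := by
  have h : vee g x y = vee g y x :=
    (Submodule.Quotient.eq _).2 (Submodule.subset_span ⟨x, y, rfl⟩)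
  exact congrArg (Submodule.mkQ _) h

theorem kappa_invariant (x y z : g) : kappa g ⁅x, y⁆ z = kappa g x ⁅y, z⁆ :=
  (Submodule.Quotient.eq _).2 (Submodule.subset_span ⟨x, y, z, rfl⟩)

theorem exists_lift_kappa {W : Type*} [AddCommGroup W] [Module ℝ W] (B : g →ₗ[ℝ] g →ₗ[ℝ] W)
    (hs : ∀ x y, B x y = B y x) (hi : ∀ x y z, B ⁅x, y⁆ z = B x ⁅y, z⁆) :
    ∃ L : VSpace g →ₗ[ℝ] W, ∀ x y, L (kappa g x y) = B x y := by
  let L₁ : SymSq g →ₗ[ℝ] W := Submodule.liftQ _ (TensorProduct.lift B) (by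
    refine Submodule.span_le.2 ?_
    rintro _ ⟨x, y, rfl⟩
    simp [hs x y])
  have hL₁ (x y : g) : L₁ (vee g x y) = B x y := by
    simp [L₁, vee]
  let L₂ : VSpace g →ₗ[ℝ] W := Submodule.liftQ _ L₁ (by
    refine Submodule.span_le.2 ?_
    rintro _ ⟨x, y, z, rfl⟩
    simp [hL₁, hi x y z])
  exact ⟨L₂, fun x y => hL₁ x y⟩

theorem span_range_kappa :
    (⊤ : Submodule ℝ (VSpace g)) ≤
      Submodule.span ℝ (Set.range fun p : g × g => kappa g p.1 p.2) := by
  rintro v -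
  obtain ⟨w, rfl⟩ := Submodule.mkQ_surjective _ v
  obtain ⟨t, rfl⟩ := Submodule.mkQ_surjective _ w
  induction t using TensorProduct.induction_on with
  | zero => simp
  | tmul x y => exact Submodule.subset_span ⟨(x, y), rfl⟩
  | add a b ha hb =>
    rw [map_add, map_add]
    exact add_mem ha hb

/-- A basis of `V_g` can be chosen among the values of `κ`, since these span; the `c i` are its
coordinate functionals. -/
theorem exists_kappa_decomposition (g : Type*) [LieRing g] [LieAlgebra ℝ g]
    [FiniteDimensional ℝ g] :
    ∃ (n : ℕ) (x y : Fin n → g) (c : Fin n → VSpace g →ₗ[ℝ] ℝ),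
      ∀ v, ∑ i, c i v • kappa g (x i) (y i) = v := by
  let b := Module.Basis.ofSpan (span_range_kappa (g := g))
  have := FiniteDimensional.fintypeBasisIndex b
  let b' := b.reindex (Fintype.equivFin _)
  have h (i) : ∃ p : g × g, kappa g p.1 p.2 = b' i :=
    Module.Basis.ofSpan_subset span_range_kappa ⟨(Fintype.equivFin _).symm i, by simp [b', b]⟩
  choose p hp using h
  refine ⟨_, fun i => (p i).1, fun i => (p i).2, b'.coord, fun v => ?_⟩
  simp only [hp]
  exact b'.sum_repr v

end Target

/-! ### Invariant forms on elementary tensors and the factorization. -/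

section Forms

variable {E : Type*} [NormedAddCommGroup E] [NormedSpace ℝ E]
variable {M : Type*} [TopologicalSpace M] [ChartedSpace E M]
variable {g : Type*} [LieRing g] [LieAlgebra ℝ g] [FiniteDimensional ℝ g]
variable {W : Type*} [AddCommGroup W] [Module ℝ W]

theorem tens_lie_tens (a b : CcSmoothMap E M ℝ) (x y : g) :
    ⁅tens a x, tens b y⁆ = tens (a * b) ⁅x, y⁆ := by
  ext p
  simp [mul_smul, smul_comm (a p)]

theorem pointwise_tens {V : Type*} [AddCommGroup V] [Module ℝ V] [FiniteDimensional ℝ V]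
    (κ : g →ₗ[ℝ] g →ₗ[ℝ] V) (a b : CcSmoothMap E M ℝ) (x y : g) :
    pointwise κ (tens a x) (tens b y) = tens (a * b) (κ x y) := by
  ext p
  simp [mul_smul, smul_comm (a p)]

variable {γ : CcSmoothMap E M g →ₗ[ℝ] CcSmoothMap E M g →ₗ[ℝ] W}

theorem form_tens_lie (hi : ∀ x y z, γ ⁅x, y⁆ z = γ x ⁅y, z⁆) (a b c : CcSmoothMap E M ℝ)
    (x y z : g) : γ (tens (a * b) ⁅x, y⁆) (tens c z) = γ (tens a x) (tens (b * c) ⁅y, z⁆) := by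
  rw [← tens_lie_tens, hi, tens_lie_tens]

/-- For `u = [x, y]` both sides equal `γ(a ⊗ x, bdc ⊗ [y, z])` by invariance. Perfectness extends
this linearly to all `u`. -/
theorem form_tens_mul (hg : ⁅(⊤ : LieIdeal ℝ g), (⊤ : LieIdeal ℝ g)⁆ = ⊤)
    (hi : ∀ x y z, γ ⁅x, y⁆ z = γ x ⁅y, z⁆) (a b d c : CcSmoothMap E M ℝ) (u z : g) :
    γ (tens (a * b * d) u) (tens c z) = γ (tens (a * b) u) (tens (d * c) z) := by
  have hu : u ∈ Submodule.span ℝ {⁅x, n⁆ | (x ∈ (⊤ : LieIdeal ℝ g)) (n ∈ (⊤ : LieIdeal ℝ g))} := by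
    rw [← LieSubmodule.lieIdeal_oper_eq_linear_span', hg]
    trivial
  induction hu using Submodule.span_induction with
  | mem u hu =>
    obtain ⟨x, -, y, -, rfl⟩ := hu
    rw [mul_assoc, form_tens_lie hi, form_tens_lie hi, mul_assoc]
  | zero => simp
  | add u v _ _ hu hv => simp [hu, hv]
  | smul r u _ hu => simp [hu]

/-- Writing `a = χ χ a` supplies the two spare factors that `form_tens_mul` needs in order to move
`a` across. -/
theorem form_tens_of_mul_eq (hg : ⁅(⊤ : LieIdeal ℝ g), (⊤ : LieIdeal ℝ g)⁆ = ⊤)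
    (hi : ∀ x y z, γ ⁅x, y⁆ z = γ x ⁅y, z⁆) {a χ : CcSmoothMap E M ℝ} (ha : χ * a = a)
    (c : CcSmoothMap E M ℝ) (u z : g) :
    γ (tens a u) (tens c z) = γ (tens (χ * χ) u) (tens (a * c) z) := by
  rw [← form_tens_mul hg hi, mul_assoc, ha, ha]

theorem form_tens_congr_right (hg : ⁅(⊤ : LieIdeal ℝ g), (⊤ : LieIdeal ℝ g)⁆ = ⊤)
    (hi : ∀ x y z, γ ⁅x, y⁆ z = γ x ⁅y, z⁆) {a χ c c' : CcSmoothMap E M ℝ} (ha : χ * a = a)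
    (hc : a * c = a * c') (u z : g) :
    γ (tens a u) (tens c z) = γ (tens a u) (tens c' z) := by
  rw [form_tens_of_mul_eq hg hi ha, form_tens_of_mul_eq hg hi ha, hc]

/-- Moving `a` to the second argument, applying symmetry of `γ` and replacing `χ²` by `χ` gives
symmetry on `g`. Splitting `a = a χ` before using invariance of `γ` gives invariance on `g`. -/
theorem exists_lift_form_tens {V : Type*} [AddCommGroup V] [Module ℝ V] {κ : g →ₗ[ℝ] g →ₗ[ℝ] V}
    (hlift : ∀ B : g →ₗ[ℝ] g →ₗ[ℝ] W, (∀ x y, B x y = B y x) →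
      (∀ x y z, B ⁅x, y⁆ z = B x ⁅y, z⁆) → ∃ L : V →ₗ[ℝ] W, ∀ x y, L (κ x y) = B x y)
    (hg : ⁅(⊤ : LieIdeal ℝ g), (⊤ : LieIdeal ℝ g)⁆ = ⊤)
    (hs : ∀ x y, γ x y = γ y x) (hi : ∀ x y z, γ ⁅x, y⁆ z = γ x ⁅y, z⁆)
    {a χ : CcSmoothMap E M ℝ} (ha : χ * a = a) :
    ∃ L : V →ₗ[ℝ] W, ∀ x y, L (κ x y) = γ (tens a x) (tens χ y) := by
  have ha' : a * χ = a := by rw [mul_comm, ha]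
  refine hlift (γ.compl₁₂ (tens a) (tens χ)) (fun x y => ?_) fun x y z => ?_
  · change γ (tens a x) (tens χ y) = γ (tens a y) (tens χ x)
    rw [form_tens_of_mul_eq hg hi ha, ha', hs]
    exact form_tens_congr_right hg hi ha (by rw [← mul_assoc, ha', ha']) y x
  · change γ (tens a ⁅x, y⁆) (tens χ z) = γ (tens a x) (tens χ ⁅y, z⁆)
    conv_lhs => rw [← ha', form_tens_lie hi]
    exact form_tens_congr_right hg hi ha (by rw [← mul_assoc, ha', ha']) x _

theorem form_tens_eq (hg : ⁅(⊤ : LieIdeal ℝ g), (⊤ : LieIdeal ℝ g)⁆ = ⊤)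
    (hi : ∀ x y z, γ ⁅x, y⁆ z = γ x ⁅y, z⁆) {a b χ : CcSmoothMap E M ℝ} (ha : χ * a = a)
    (u z : g) : γ (tens a u) (tens b z) = γ (tens (a * b) u) (tens χ z) := by
  have hab : χ * (a * b) = a * b := by rw [← mul_assoc, ha]
  rw [form_tens_of_mul_eq hg hi ha, form_tens_of_mul_eq hg hi hab, mul_comm (a * b), hab]

theorem CcSmoothMap.mul_comp_eq {V : Type*} [AddCommGroup V] [Module ℝ V]
    [FiniteDimensional ℝ V] {F : CcSmoothMap E M V} {χ : CcSmoothMap E M ℝ}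
    (hχ : ∀ p ∈ tsupport F, χ p = 1) (c : V →ₗ[ℝ] ℝ) :
    χ * CcSmoothMap.comp c F = CcSmoothMap.comp c F := by
  ext p
  by_cases hp : F p = 0
  · simp [hp]
  · simp [hχ p (subset_tsupport _ hp)]

variable {V : Type*} [AddCommGroup V] [Module ℝ V] [FiniteDimensional ℝ V]
variable {κ : g →ₗ[ℝ] g →ₗ[ℝ] V}
variable {n : ℕ} {x y : Fin n → g} {c : Fin n → V →ₗ[ℝ] ℝ}

theorem sum_pointwise_tens (hc : ∀ v, ∑ i, c i v • κ (x i) (y i) = v) {F : CcSmoothMap E M V}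
    {χ : CcSmoothMap E M ℝ} (hχ : ∀ p ∈ tsupport F, χ p = 1) :
    ∑ i, pointwise κ (tens (CcSmoothMap.comp (c i) F) (x i)) (tens χ (y i)) = F := by
  have h (i) : CcSmoothMap.comp (c i) F * χ = CcSmoothMap.comp (c i) F := by
    rw [mul_comm, CcSmoothMap.mul_comp_eq hχ]
  simp only [pointwise_tens, h]
  ext p
  simp [hc]

variable [IsManifold 𝓘(ℝ, E) ∞ M] [T2Space M] [FiniteDimensional ℝ E] [SigmaCompactSpace M]

/-- Independence of the cut-off makes the sum linear in `F`: two maps can be compared using one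
cut-off for the union of their supports. -/
theorem exists_linear_eq_sum_form (hg : ⁅(⊤ : LieIdeal ℝ g), (⊤ : LieIdeal ℝ g)⁆ = ⊤)
    (hi : ∀ x y z, γ ⁅x, y⁆ z = γ x ⁅y, z⁆) (x y : Fin n → g) (c : Fin n → V →ₗ[ℝ] ℝ) :
    ∃ ψ : CcSmoothMap E M V →ₗ[ℝ] W,
      ∀ (F : CcSmoothMap E M V) (χ : CcSmoothMap E M ℝ), (∀ p ∈ tsupport F, χ p = 1) →
        ψ F = ∑ i, γ (tens (CcSmoothMap.comp (c i) F) (x i)) (tens χ (y i)) := by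
  choose cut hcut using fun F : CcSmoothMap E M V =>
    exists_cutoff E F.hasCompactSupport.isCompact
  let S (F : CcSmoothMap E M V) (χ : CcSmoothMap E M ℝ) : W :=
    ∑ i, γ (tens (CcSmoothMap.comp (c i) F) (x i)) (tens χ (y i))
  have hS {F : CcSmoothMap E M V} {χ χ' : CcSmoothMap E M ℝ}
      (hχ : ∀ p ∈ tsupport F, χ p = 1) (hχ' : ∀ p ∈ tsupport F, χ' p = 1) : S F χ = S F χ' := by
    refine Finset.sum_congr rfl fun i _ => ?_
    refine form_tens_congr_right hg hi (CcSmoothMap.mul_comp_eq hχ (c i)) ?_ _ _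
    rw [mul_comm, CcSmoothMap.mul_comp_eq hχ, mul_comm, CcSmoothMap.mul_comp_eq hχ']
  refine ⟨
    { toFun := fun F => S F (cut F)
      map_add' := fun F G => ?_
      map_smul' := fun r F => ?_ }, fun F χ hχ => hS (hcut F) hχ⟩
  · obtain ⟨χ, hχ⟩ := exists_cutoff E
      (F.hasCompactSupport.isCompact.union G.hasCompactSupport.isCompact)
    rw [hS (hcut F) fun p hp => hχ p (Or.inl hp), hS (hcut G) fun p hp => hχ p (Or.inr hp),
      hS (hcut (F + G)) fun p hp => hχ p (tsupport_add F G hp)]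
    simp [S, Finset.sum_add_distrib]
  · rw [hS (hcut (r • F)) fun p hp =>
      hcut F p (tsupport_smul_subset_of_subset (f := F) r subset_rfl hp)]
    simp [S, Finset.smul_sum]

theorem exists_linear_factorization
    (hlift : ∀ B : g →ₗ[ℝ] g →ₗ[ℝ] W, (∀ x y, B x y = B y x) →
      (∀ x y z, B ⁅x, y⁆ z = B x ⁅y, z⁆) → ∃ L : V →ₗ[ℝ] W, ∀ x y, L (κ x y) = B x y)
    (hg : ⁅(⊤ : LieIdeal ℝ g), (⊤ : LieIdeal ℝ g)⁆ = ⊤)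
    (hs : ∀ x y, γ x y = γ y x) (hi : ∀ x y z, γ ⁅x, y⁆ z = γ x ⁅y, z⁆)
    (hc : ∀ v, ∑ i, c i v • κ (x i) (y i) = v) :
    ∃ ψ : CcSmoothMap E M V →ₗ[ℝ] W, (∀ f h, γ f h = ψ (pointwise κ f h)) ∧
      ∀ (F : CcSmoothMap E M V) (χ : CcSmoothMap E M ℝ), (∀ p ∈ tsupport F, χ p = 1) →
        ψ F = ∑ i, γ (tens (CcSmoothMap.comp (c i) F) (x i)) (tens χ (y i)) := by
  obtain ⟨ψ, hψ⟩ := exists_linear_eq_sum_form hg hi x y c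
  have hψt (a b : CcSmoothMap E M ℝ) (u z : g) :
      γ (tens a u) (tens b z) = ψ (tens (a * b) (κ u z)) := by
    obtain ⟨χ, hχ⟩ := exists_cutoff E a.hasCompactSupport.isCompact
    have ha : χ * a = a := by
      ext p
      by_cases hp : a p = 0
      · simp [hp]
      · simp [hχ p (subset_tsupport _ hp)]
    have hab : χ * (a * b) = a * b := by rw [← mul_assoc, ha]
    -- `L` depends on the product `a * b`, but expanding `κ u z` under it produces exactly the sum
    -- defining `ψ`.
    obtain ⟨L, hL⟩ := exists_lift_form_tens hlift hg hs hi hab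
    have hsub : Function.support (tens (a * b) (κ u z)) ⊆ Function.support a := by
      intro q hq hq0
      exact hq (by simp [hq0])
    have hcomp (i) : CcSmoothMap.comp (c i) (tens (a * b) (κ u z)) = c i (κ u z) • (a * b) := by
      ext p
      simp [mul_comm]
    calc γ (tens a u) (tens b z) = L (κ u z) := by rw [form_tens_eq hg hi ha, hL]
      _ = L (∑ i, c i (κ u z) • κ (x i) (y i)) := by rw [hc]
      _ = ψ (tens (a * b) (κ u z)) := by
        rw [hψ _ χ fun p hp => hχ p (closure_mono hsub hp)]
        simp [hcomp, hL]
  refine ⟨ψ, fun f h => ?_, hψ⟩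
  let e := Module.finBasis ℝ g
  rw [f.eq_sum_tens e, h.eq_sum_tens e]
  simp only [map_sum, LinearMap.sum_apply]
  exact Finset.sum_congr rfl fun i _ => Finset.sum_congr rfl fun j _ => by
    rw [hψt, pointwise_tens]

theorem existsUnique_continuous_factorization [TopologicalSpace W]
    (hlift : ∀ B : g →ₗ[ℝ] g →ₗ[ℝ] W, (∀ x y, B x y = B y x) →
      (∀ x y z, B ⁅x, y⁆ z = B x ⁅y, z⁆) → ∃ L : V →ₗ[ℝ] W, ∀ x y, L (κ x y) = B x y)
    (hc : ∀ v, ∑ i, c i v • κ (x i) (y i) = v)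
    (hg : ⁅(⊤ : LieIdeal ℝ g), (⊤ : LieIdeal ℝ g)⁆ = ⊤) (hγ : IsContinuousInvariantForm γ) :
    ∃! ψ : CcSmoothMap E M (V) →L[ℝ] W, ∀ f h, γ f h = ψ (pointwise (κ) f h) := by
  have := hγ.isLocallyConvexSpace.isTopologicalAddGroup
  have := hγ.isLocallyConvexSpace.continuousSMul
  have := hγ.isLocallyConvexSpace.locallyConvex
  obtain ⟨ψ, hψ, hψF⟩ := exists_linear_factorization hlift hg hγ.symm hγ.invariant hc
  have hcont : Continuous ψ := by
    refine CcSmoothMap.continuous_of_toCc ψ fun K hK => ?_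
    obtain ⟨χ, hχ⟩ := exists_cutoff E hK
    -- Since `χ F = F` on `C^∞_K`, the map `F ↦ (cᵢ ∘ F) ⊗ xᵢ` is the pointwise product of the fixed
    -- `χ` with `F` under `β i`, so its continuity is a case of `continuous_pointwise`.
    let β (i : Fin n) : ℝ →ₗ[ℝ] V →ₗ[ℝ] g :=
      (LinearMap.lsmul ℝ g).compl₂ ((c i).smulRight (x i))
    have h (f : SmoothMapOn E (V) K) : ψ (f.toCc hK) =
        ∑ i, γ (pointwise (β i) χ (f.toCc hK)) (tens χ (y i)) := by
      have hsupp : ∀ p ∈ tsupport (f.toCc hK), χ p = 1 := fun p hp => hχ p (f.2 hp)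
      rw [hψF _ χ hsupp]
      refine Finset.sum_congr rfl fun i _ => ?_
      congr 2
      rw [← CcSmoothMap.mul_comp_eq hsupp]
      ext p
      rw [tens_apply, CcSmoothMap.mul_apply, mul_smul]
      rfl
    simp only [h]
    refine continuous_finsetSum _ fun i _ => ?_
    exact hγ.continuous.comp (((continuous_pointwise (β i)).comp
      (continuous_const.prodMk (continuous_toCc hK))).prodMk continuous_const)
  refine ⟨⟨ψ, hcont⟩, hψ, fun φ hφ => ContinuousLinearMap.ext fun F => ?_⟩
  obtain ⟨χ, hχ⟩ := exists_cutoff E F.hasCompactSupport.isCompact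
  -- Every `F` is a finite sum of values of the form, so `φ` and `ψ` agree on it.
  rw [← sum_pointwise_tens hc hχ, map_sum, map_sum]
  exact Finset.sum_congr rfl fun i _ => (hφ _ _).symm.trans (hψ _ _)

end Forms

end UnivForm

end

/-! ### The universality theorem. -/

theorem mainTheorem2
    {E : Type uE} [NormedAddCommGroup E] [NormedSpace ℝ E] [FiniteDimensional ℝ E]
    {M : Type uM} [TopologicalSpace M] [ChartedSpace E M] [IsManifold 𝓘(ℝ, E) ∞ M]
    [T2Space M] [SigmaCompactSpace M]
    {g : Type ug} [LieRing g] [LieAlgebra ℝ g] [FiniteDimensional ℝ g]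
    (hg : ⁅(⊤ : LieIdeal ℝ g), (⊤ : LieIdeal ℝ g)⁆ = ⊤) :
    UnivForm.IsTopologicallyUniversal.{max uM ug, max uM ug, uW}
      (UnivForm.pointwise (UnivForm.kappa g) :
        UnivForm.CcSmoothMap E M g →ₗ[ℝ] UnivForm.CcSmoothMap E M g →ₗ[ℝ]
          UnivForm.CcSmoothMap E M (UnivForm.VSpace g)) where
  isLocallyConvexLieAlgebra :=
    { isLocallyConvexSpace := UnivForm.CcSmoothMap.isLocallyConvexSpace
      continuous_lie := UnivForm.continuous_pointwise _ }
  isContinuousInvariantForm :=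
    { isLocallyConvexSpace := UnivForm.CcSmoothMap.isLocallyConvexSpace
      symm := fun _ _ => UnivForm.CcSmoothMap.ext fun _ => UnivForm.kappa_symm _ _
      invariant := fun _ _ _ => UnivForm.CcSmoothMap.ext fun _ => UnivForm.kappa_invariant _ _ _
      continuous := UnivForm.continuous_pointwise _ }
  existsUnique := fun _ _ _ _ _ hγ => by
    obtain ⟨_, _, _, _, hc⟩ := UnivForm.exists_kappa_decomposition g
    exact UnivForm.existsUnique_continuous_factorization UnivForm.exists_lift_kappa hc hg hγ
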